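/- For $p,q\ge 0$ let $C\ell_{p,q}$ be the real Clifford algebra of $\mathbb R^{p+q}$ with the quadratic form $Q(x)=x_1^2+\dots+x_p^2-x_{p+1}^2-\dots-x_{p+q}^2$ (so $x^2=Q(x)$ for vectors $x$), let $C\ell^{+}_{p,q}$ and $C\ell^{-}_{p,q}$ be its even and odd parts, let $s\mapsto\tilde s$ be the reversion, and put $N(s)=s\tilde s$. Let $$\mathbf{Pin}(p,q)=\{\,s\in C\ell^{+}_{p,q}\cup C\ell^{-}_{p,q}\ \text{invertible}\ :\ s x s^{-1}\in\mathbb R^{p+q}\ \text{for all } x\in\mathbb R^{p+q},\ N(s)=\pm1\,\},$$ a group under multiplication, with the topology induced from the finite-dimensional real vector space $C\ell_{p,q}$. Let $SU(2)$ be the special unitary group of complex $2\times2$ matrices, and let $Sp(2)$ be the compact symplectic group, i.e. the group of unitary complex $4\times 4$ matrices that preserve the standard symplectic form on $\mathbb C^4$. Let $i$ be the scalar imaginary unit of $\mathbb C$, and let $e$ be a double unit: $e^2=1$, adjoined as a scalar, so that $e$ belongs to the ring of double complex numbers $\mathbb C\oplus e\,\mathbb C$ (isomorphic to $\mathbb C\times\mathbb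 C$, with $\mathbb C$ embedded diagonally and $e=(1,-1)$). For $G=SU(2)$ or $G=Sp(2)$, the sets $G\cup iG$ (inside the complex matrices) and $G\cup eG$ (inside the matrices over the double complex numbers) are topological groups under matrix multiplication. **Theorem.** There are isomorphisms of topological groups $$\mathbf{Pin}(3,0)\simeq SU(2)\cup i\,SU(2),\qquad \mathbf{Pin}(0,3)\simeq SU(2)\cup e\,SU(2),$$ $$\mathbf{Pin}(5,0)\simeq Sp(2)\cup e\,Sp(2),\qquad \mathbf{Pin}(0,5)\simeq Sp(2)\cup i\,Sp(2).$$ -/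

import Mathlib

noncomputable section

namespace CliffordLipschitz

open CliffordAlgebra

/-- The standard quadratic form `x₁² + ⋯ + x_p² - x_{p+1}² - ⋯ - x_{p+q}²` on `ℝ^{p+q}`. -/
def form (p q : ℕ) : QuadraticForm ℝ (Fin (p + q) → ℝ) :=
  QuadraticMap.weightedSumSquares ℝ (fun i : Fin (p + q) => if (i : ℕ) < p then (1 : ℝ) else -1)

/-- The real Clifford algebra of signature `(p, q)`, in which `v * v = Q(v)` for vectors `v`. -/
abbrev Cl (p q : ℕ) : Type := CliffordAlgebra (form p q)

/-- `s` lies in the even part or in the odd part of the Clifford algebra. -/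
def IsHomogeneous {p q : ℕ} (s : Cl p q) : Prop :=
  s ∈ evenOdd (form p q) 0 ∨ s ∈ evenOdd (form p q) 1

theorem IsHomogeneous.mul {p q : ℕ} {s t : Cl p q} (hs : IsHomogeneous s)
    (ht : IsHomogeneous t) : IsHomogeneous (s * t) := by
  have key : ∀ i j : ZMod 2, s ∈ evenOdd (form p q) i → t ∈ evenOdd (form p q) j →
      s * t ∈ evenOdd (form p q) (i + j) := fun i j h k => SetLike.mul_mem_graded h k
  rcases hs with hs | hs <;> rcases ht with ht | ht
  · exact Or.inl (key 0 0 hs ht)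
  · exact Or.inr (key 0 1 hs ht)
  · exact Or.inr (key 1 0 hs ht)
  · exact Or.inl (key 1 1 hs ht)

theorem eq_zero_of_eq_neg {p q : ℕ} {x : Cl p q} (h : x = -x) : x = 0 := by
  have h2 : (2 : ℝ) • x = 0 := by
    rw [two_smul]
    nth_rewrite 1 [h]
    exact neg_add_cancel x
  exact (smul_eq_zero.1 h2).resolve_left two_ne_zero

theorem IsHomogeneous.of_involute {p q : ℕ} {s : Cl p q}
    (hs : involute s = s ∨ involute s = -s) : IsHomogeneous s := by
  have h : s ∈ evenOdd (form p q) 0 ⊔ evenOdd (form p q) 1 := by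
    rw [(evenOdd_isCompl (Q := form p q)).sup_eq_top]
    exact Submodule.mem_top
  obtain ⟨a, ha, b, hb, rfl⟩ := Submodule.mem_sup.1 h
  rw [map_add, involute_eq_of_mem_even ha, involute_eq_of_mem_odd hb] at hs
  rcases hs with hs | hs
  · left
    have hb0 : b = 0 := eq_zero_of_eq_neg (add_left_cancel hs).symm
    rwa [hb0, add_zero]
  · right
    rw [neg_add] at hs
    have ha0 : a = 0 := eq_zero_of_eq_neg (add_right_cancel hs)
    rwa [ha0, zero_add]

theorem IsHomogeneous.inv {p q : ℕ} {s : (Cl p q)ˣ} (hs : IsHomogeneous (s : Cl p q)) :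
    IsHomogeneous ((s⁻¹ : (Cl p q)ˣ) : Cl p q) := by
  have h1 : involute (s : Cl p q) * involute ((s⁻¹ : (Cl p q)ˣ) : Cl p q) = 1 := by
    rw [← map_mul, Units.mul_inv, map_one]
  apply IsHomogeneous.of_involute
  rcases hs with hs | hs
  · left
    rw [involute_eq_of_mem_even hs] at h1
    exact (Units.inv_eq_of_mul_eq_one_right h1).symm
  · right
    rw [involute_eq_of_mem_odd hs, neg_mul, ← mul_neg] at h1
    have h2 := Units.inv_eq_of_mul_eq_one_right h1
    exact (neg_eq_iff_eq_neg.2 h2).symm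

theorem vector_injective (p q : ℕ) : Function.Injective (ι (form p q)) := by
  have : Invertible (2 : ℝ) := invertibleOfNonzero two_ne_zero
  intro x y h
  have h' := congrArg (equivExterior (form p q)) h
  simp only [equivExterior, changeFormEquiv_apply, changeForm_ι] at h'
  exact ExteriorAlgebra.ι_leftInverse.injective h'

/-- The Lipschitz group: the invertible `s` in the even or odd part of the Clifford algebra with
`s x s⁻¹` a vector for every vector `x`. -/
def Lipschitz (p q : ℕ) : Subgroup (Cl p q)ˣ where
  carrier := {s | IsHomogeneous (s : Cl p q) ∧ ∀ x : Fin (p + q) → ℝ, ∃ y : Fin (p + q) → ℝ,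
    (s : Cl p q) * ι (form p q) x * ((s⁻¹ : (Cl p q)ˣ) : Cl p q) = ι (form p q) y}
  one_mem' := ⟨Or.inl (by simpa using SetLike.one_mem_graded (evenOdd (form p q))),
    fun x => ⟨x, by simp⟩⟩
  mul_mem' := by
    rintro s t ⟨hs, hs'⟩ ⟨ht, ht'⟩
    refine ⟨by simpa using hs.mul ht, fun x => ?_⟩
    obtain ⟨y, hy⟩ := ht' x
    obtain ⟨z, hz⟩ := hs' y
    refine ⟨z, ?_⟩
    rw [← hz, ← hy]
    simp [mul_assoc]
  inv_mem' := by
    rintro s ⟨hs, hs'⟩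
    refine ⟨hs.inv, ?_⟩
    choose f hf using hs'
    have hι : Function.Injective (ι (form p q)) := vector_injective p q
    let g : (Fin (p + q) → ℝ) →ₗ[ℝ] (Fin (p + q) → ℝ) :=
      { toFun := f
        map_add' := fun x y => hι (by rw [map_add, ← hf, ← hf, ← hf, map_add]; noncomm_ring)
        map_smul' := fun c x => hι (by rw [map_smul, ← hf, ← hf, map_smul]; simp) }
    have hg : Function.Injective g := by
      intro x y hxy
      have h : ι (form p q) (f x) = ι (form p q) (f y) := congrArg _ hxy
      rw [← hf, ← hf] at h
      exact hι ((Units.mul_right_inj s).1 ((Units.mul_left_inj s⁻¹).1 h))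
    intro x
    obtain ⟨y, hy⟩ := LinearMap.injective_iff_surjective.1 hg x
    refine ⟨y, ?_⟩
    have h : f y = x := hy
    rw [← h, ← hf]
    simp [mul_assoc]

/-- The quadratic character `N(s) = s s̃`, where `s ↦ s̃` is the reversion. -/
def spinorNorm {p q : ℕ} (s : Cl p q) : Cl p q := s * reverse s

/-- `Pin(p, q)`: the `s` in the Lipschitz group with `N(s) = ±1`. -/
def Pin (p q : ℕ) : Subgroup (Cl p q)ˣ where
  carrier := {s | s ∈ Lipschitz p q ∧
    (spinorNorm (s : Cl p q) = 1 ∨ spinorNorm (s : Cl p q) = -1)}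
  one_mem' := ⟨one_mem _, Or.inl (by simp [spinorNorm])⟩
  mul_mem' := by
    rintro s t ⟨hs, hs'⟩ ⟨ht, ht'⟩
    refine ⟨mul_mem hs ht, ?_⟩
    have h : spinorNorm ((s * t : (Cl p q)ˣ) : Cl p q) =
        (s : Cl p q) * spinorNorm (t : Cl p q) * reverse (s : Cl p q) := by
      simp [spinorNorm, mul_assoc]
    rw [h]
    unfold spinorNorm at *
    rcases hs' with hs' | hs' <;> rcases ht' with ht' | ht' <;> simp [hs', ht']
  inv_mem' := by
    rintro s ⟨hs, hs'⟩
    refine ⟨inv_mem hs, ?_⟩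
    have h : reverse ((s⁻¹ : (Cl p q)ˣ) : Cl p q) * reverse (s : Cl p q) = 1 := by
      rw [← reverse.map_mul, Units.mul_inv, reverse.map_one]
    unfold spinorNorm at *
    rcases hs' with hs' | hs'
    · left
      rw [← Units.inv_eq_of_mul_eq_one_right hs'] at h
      have h2 := congrArg (fun u => (s : Cl p q) * u) (Units.inv_eq_of_mul_eq_one_right hs')
      have h3 : reverse ((s⁻¹ : (Cl p q)ˣ) : Cl p q) = s := by
        have := congrArg (fun u => u * (s : Cl p q)) h
        simpa [mul_assoc] using this
      rw [h3, Units.inv_mul]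
    · right
      have h1 : (s : Cl p q) * -reverse (s : Cl p q) = 1 := by rw [mul_neg, hs', neg_neg]
      have h2 : reverse (s : Cl p q) = -((s⁻¹ : (Cl p q)ˣ) : Cl p q) := by
        rw [Units.inv_eq_of_mul_eq_one_right h1, neg_neg]
      rw [h2] at h
      have h3 : reverse ((s⁻¹ : (Cl p q)ˣ) : Cl p q) = -s := by
        have := congrArg (fun u => u * (s : Cl p q)) h
        simp [mul_assoc] at this
        rw [← this, neg_neg]
      rw [h3, mul_neg, Units.inv_mul]

/-- The usual topology of `Pin(p, q)` as a linear group: the subspace topology from the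
finite-dimensional real vector space underlying the Clifford algebra. -/
instance (p q : ℕ) : TopologicalSpace (Pin p q) :=
  TopologicalSpace.induced (fun s : Pin p q => ((s : (Cl p q)ˣ) : Cl p q))
    (moduleTopology ℝ (Cl p q))

/-- For a group `S` of matrices and a scalar `c` with `c² ∈ S`, the group `S ∪ c S`. -/
def unionScalar {n R : Type*} [Fintype n] [DecidableEq n] [CommRing R]
    (S : Submonoid (Matrix n n R)) (c : R) (hc : (c * c) • (1 : Matrix n n R) ∈ S) :
    Submonoid (Matrix n n R) where
  carrier := {A | A ∈ S} ∪ {A | ∃ B ∈ S, A = c • B}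
  one_mem' := Or.inl (one_mem S)
  mul_mem' := by
    rintro A B (hA | ⟨A', hA, rfl⟩) (hB | ⟨B', hB, rfl⟩)
    · exact Or.inl (S.mul_mem hA hB)
    · exact Or.inr ⟨A * B', mul_mem hA hB, by simp⟩
    · exact Or.inr ⟨A' * B, mul_mem hA hB, by simp⟩
    · left
      have h := mul_mem hc (mul_mem hA hB)
      simpa [smul_smul] using h

/-- `SU(2)`. -/
abbrev SU2 : Submonoid (Matrix (Fin 2) (Fin 2) ℂ) := Matrix.specialUnitaryGroup (Fin 2) ℂ

/-- The compact symplectic group `Sp(2)`: the unitary `4 × 4` matrices that preserve the standard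
symplectic form. -/
def Sp2 : Submonoid (Matrix (Fin 2 ⊕ Fin 2) (Fin 2 ⊕ Fin 2) ℂ) :=
  Matrix.unitaryGroup (Fin 2 ⊕ Fin 2) ℂ ⊓ Matrix.symplecticGroup (Fin 2) ℂ

/-- The double complex numbers `ℂ ⊕ e ℂ` with `e² = 1`, as the ring `ℂ × ℂ`. A complex number `z`
is identified with `(z, z)`, so that `a + e b` is `(a + b, a - b)`. -/
abbrev DoubleComplex : Type := ℂ × ℂ

/-- The double unit `e`. -/
def doubleUnit : DoubleComplex := (1, -1)

/-- The inclusion of the complex numbers into the double complex numbers. -/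
def ofComplex : ℂ →+* DoubleComplex := (RingHom.id ℂ).prod (RingHom.id ℂ)

theorem doubleUnit_mul_self : doubleUnit * doubleUnit = 1 := by
  simp [doubleUnit]

/-- A group of complex matrices, regarded as matrices over the double complex numbers. -/
def toDouble {n : Type*} [Fintype n] [DecidableEq n] (S : Submonoid (Matrix n n ℂ)) :
    Submonoid (Matrix n n DoubleComplex) :=
  S.map (ofComplex.mapMatrix : Matrix n n ℂ →+* Matrix n n DoubleComplex)

/-- `SU(2) ∪ i SU(2)`, inside the complex `2 × 2` matrices. -/
def SU2UnionI : Submonoid (Matrix (Fin 2) (Fin 2) ℂ) :=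
  unionScalar SU2 Complex.I (by
    rw [Complex.I_mul_I, Matrix.mem_specialUnitaryGroup_iff, Matrix.mem_unitaryGroup_iff]
    constructor <;> simp [Matrix.det_fin_two])

/-- `SU(2) ∪ e SU(2)`, inside the double complex `2 × 2` matrices. -/
def SU2UnionE : Submonoid (Matrix (Fin 2) (Fin 2) DoubleComplex) :=
  unionScalar (toDouble SU2) doubleUnit (by
    rw [doubleUnit_mul_self, one_smul]
    exact one_mem _)

/-- `Sp(2) ∪ e Sp(2)`, inside the double complex `4 × 4` matrices. -/
def Sp2UnionE : Submonoid (Matrix (Fin 2 ⊕ Fin 2) (Fin 2 ⊕ Fin 2) DoubleComplex) :=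
  unionScalar (toDouble Sp2) doubleUnit (by
    rw [doubleUnit_mul_self, one_smul]
    exact one_mem _)

/-- `Sp(2) ∪ i Sp(2)`, inside the complex `4 × 4` matrices. -/
def Sp2UnionI : Submonoid (Matrix (Fin 2 ⊕ Fin 2) (Fin 2 ⊕ Fin 2) ℂ) :=
  unionScalar Sp2 Complex.I (by
    rw [Complex.I_mul_I, Sp2, Submonoid.mem_inf, Matrix.mem_unitaryGroup_iff,
      SymplecticGroup.mem_iff]
    constructor <;> simp)

end CliffordLipschitz

end

/-! For n = 3 and n = 5 let A be the quaternion algebra, respectively the 2 × 2 quaternionic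
matrices, realized as the complex matrices X with XJ = JX̄. Its real dimension 2^(n-1) is that of
the even Clifford algebra, and ℝⁿ is exactly the space of trace-free Y in A with Y* = δY:
skew-Hermitian for n = 3 (δ = -1), Hermitian for n = 5 (δ = 1). Here γ(x)² = δ|x|². If Q = η|x|² and
c² = δη, then x ↦ cγ(x) satisfies the Clifford relation, so c = i serves for δη = -1 and c = e for
δη = 1; this sign decides all four cases. The even part goes onto A and the odd part onto cA; as A ∩
cA = 0, a dimension count makes the representation injective (`rep_injective`).

On even elements reversion becomes the conjugate transpose (`exists_rep_even`), so N(s) = ±1 reads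
XX* = ±1, and positivity excludes -1. Conversely, conjugation by a unitary X in A preserves the
trace and the symmetry Y* = δY, hence maps vectors to vectors (`exists_conj`): the Lipschitz
condition is automatic in these dimensions. Multiplication by a unit vector reduces odd elements to
even ones. The unitary elements of A form SU(2), respectively Sp(2) (`mem_SU2_iff`, `mem_Sp2_iff`),
and the topologies agree because an injective linear map from a finite-dimensional space is a closed
embedding (`isInducing_pin`). -/

namespace CliffordLipschitz

open CliffordAlgebra

/-! ### Quaternionic matrices as a real form of the complex matrices -/

/-- The complex matrices `X` with `X J = J X̄`, a real algebra. For real `J` with `J² = -1` they are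
the quaternionic matrices. -/
def quaternionic {m : Type*} [Fintype m] [DecidableEq m] (J : Matrix m m ℂ) :
    Subalgebra ℝ (Matrix m m ℂ) where
  carrier := {X | X * J = J * X.map (starRingEnd ℂ)}
  mul_mem' := by
    intro X Y (hX : _ = _) (hY : _ = _)
    show _ = _
    rw [Matrix.map_mul, mul_assoc, hY, ← mul_assoc, hX, mul_assoc]
  add_mem' := by
    intro X Y (hX : _ = _) (hY : _ = _)
    show _ = _
    rw [Matrix.map_add _ (map_add _), add_mul, hX, hY, mul_add]
  algebraMap_mem' := by
    intro r
    show _ = _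
    have h : (algebraMap ℝ (Matrix m m ℂ) r).map (starRingEnd ℂ) = algebraMap ℝ _ r := by
      ext i j
      by_cases hij : i = j <;> simp [Matrix.algebraMap_matrix_apply, hij]
    rw [h, Algebra.commutes]

theorem map_conj_conj {m : Type*} (X : Matrix m m ℂ) :
    (X.map (starRingEnd ℂ)).map (starRingEnd ℂ) = X := by
  ext i j
  simp

theorem map_conj_smul {m : Type*} (c : ℂ) (X : Matrix m m ℂ) :
    (c • X).map (starRingEnd ℂ) = starRingEnd ℂ c • X.map (starRingEnd ℂ) := by
  ext i j
  simp

section Quaternionic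

variable {m : Type*} [Fintype m] [DecidableEq m] {J X Y : Matrix m m ℂ}

theorem mem_quaternionic : X ∈ quaternionic J ↔ X * J = J * X.map (starRingEnd ℂ) := Iff.rfl

theorem transpose_mul_map_conj (h : Matrix.conjTranspose X * X = 1) :
    X.transpose * X.map (starRingEnd ℂ) = 1 := by
  have h2 := congrArg Matrix.transpose h
  rw [Matrix.transpose_mul, Matrix.transpose_one] at h2
  exact h2

/-- For unitary X the matrix X̄ is the inverse of Xᵀ, so commuting with the quaternionic structure
is the same as preserving the bilinear form J. -/
theorem mem_quaternionic_iff_of_unitary (h : X * X.conjTranspose = 1) :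
    X ∈ quaternionic J ↔ X * J * X.transpose = J := by
  have h1 := transpose_mul_map_conj (mul_eq_one_comm.1 h)
  have h2 : X.map (starRingEnd ℂ) * X.transpose = 1 := mul_eq_one_comm.1 h1
  rw [mem_quaternionic]
  constructor
  · intro hX
    rw [hX, mul_assoc, h2, mul_one]
  · intro hX
    conv_rhs => rw [← hX]
    rw [mul_assoc, h1, mul_one]

theorem conjTranspose_mem_quaternionic (hJ : J * J = -1)
    (hJ' : J.conjTranspose = -J)
    (hX : X ∈ quaternionic J) : X.conjTranspose ∈ quaternionic J := by
  rw [mem_quaternionic] at *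
  have h := congrArg Matrix.conjTranspose hX
  rw [Matrix.conjTranspose_mul, Matrix.conjTranspose_mul, hJ'] at h
  have h2 : (X.map (starRingEnd ℂ)).conjTranspose = X.conjTranspose.map (starRingEnd ℂ) := by
    ext i j
    simp
  rw [h2, neg_mul, mul_neg, neg_inj] at h
  have h3 := congrArg (fun Z => J * Z * J) h
  simp only [← mul_assoc, hJ] at h3
  rw [mul_assoc _ J J, hJ] at h3
  simpa using h3

/-- A ∩ iA = 0: conjugation changes the sign of i, so X = -iY turns XJ = JX̄ into -iYJ = iYJ. -/
theorem quaternionic_eq_zero (hJ : J * J = -1) (hX : X ∈ quaternionic J)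
    (hY : Y ∈ quaternionic J) (h : X + Complex.I • Y = 0) : X = 0 ∧ Y = 0 := by
  rw [mem_quaternionic] at *
  have hX' : X = -(Complex.I • Y) := eq_neg_of_add_eq_zero_left h
  have h1 : Complex.I • (Y * J) = 0 := by
    have h2 : X.map (starRingEnd ℂ) = Complex.I • Y.map (starRingEnd ℂ) := by
      rw [hX', ← smul_neg, map_conj_smul, Complex.conj_I, neg_smul]
      ext i j
      simp
    rw [h2, hX', neg_mul, Matrix.smul_mul, Matrix.mul_smul, ← hY] at hX
    have h3 : (2 : ℂ) • (Complex.I • (Y * J)) = 0 := by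
      rw [two_smul]
      nth_rewrite 1 [← hX]
      exact neg_add_cancel _
    exact (smul_eq_zero.1 h3).resolve_left two_ne_zero
  have h2 : Y * J = 0 := (smul_eq_zero.1 h1).resolve_left Complex.I_ne_zero
  have h3 : Y = 0 := by
    have := congrArg (· * J) h2
    simpa [mul_assoc, hJ] using this
  exact ⟨by rw [hX', h3, smul_zero, neg_zero], h3⟩

theorem card_sq_le_finrank_quaternionic (hJ : J * J = -1) (hJc : J.map (starRingEnd ℂ) = J) :
    Fintype.card m ^ 2 ≤ Module.finrank ℝ (quaternionic J) := by
  -- Membership means being fixed by the conjugate-linear involution X ↦ -J X̄ J; P averages over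
  -- it.
  let P : Matrix m m ℂ → Matrix m m ℂ := fun X =>
    (1 / 2 : ℝ) • (X - J * X.map (starRingEnd ℂ) * J)
  have hP : ∀ X, P X ∈ quaternionic J := by
    intro X
    refine Subalgebra.smul_mem _ ?_ _
    rw [mem_quaternionic, Matrix.map_sub _ (map_sub _), Matrix.map_mul, Matrix.map_mul,
      map_conj_conj, hJc, sub_mul, mul_sub, mul_assoc _ J J, hJ]
    simp only [← mul_assoc, hJ]
    simp only [mul_neg, mul_one, neg_mul, one_mul, sub_neg_eq_add]
    exact add_comm _ _
  let F : (quaternionic J × quaternionic J) →ₗ[ℝ] Matrix m m ℂ :=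
    { toFun := fun Z => (Z.1 : Matrix m m ℂ) + Complex.I • (Z.2 : Matrix m m ℂ)
      map_add' := fun a b => by
        simp only [Prod.fst_add, Prod.snd_add, Subalgebra.coe_add, smul_add]
        abel
      map_smul' := fun r a => by
        simp only [Prod.smul_fst, Prod.smul_snd, Subalgebra.coe_smul, smul_add, RingHom.id_apply]
        rw [smul_comm] }
  have hF : Function.Surjective F := by
    intro X
    -- P(-iX) is -i times the anti-fixed part of X, so X = P(X) + iP(-iX).
    refine ⟨(⟨P X, hP X⟩, ⟨P (-Complex.I • X), hP _⟩), ?_⟩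
    show P X + Complex.I • P (-Complex.I • X) = X
    simp only [P, map_conj_smul, map_neg, Complex.conj_I, neg_neg]
    rw [smul_comm Complex.I, Matrix.mul_smul, Matrix.smul_mul, smul_sub Complex.I, smul_smul,
      smul_smul, ← smul_add]
    simp only [mul_neg, Complex.I_mul_I, neg_neg, one_smul, neg_smul]
    rw [sub_neg_eq_add, sub_add_add_cancel, ← two_smul ℝ X, smul_smul]
    norm_num
  have h := LinearMap.finrank_le_finrank_of_surjective hF
  rw [Module.finrank_prod, Module.finrank_matrix, Complex.finrank_real_complex] at h
  nlinarith

end Quaternionic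

/-! ### Models of Euclidean space by quaternionic matrices -/

/-- A realization of the Euclidean space `ℝⁿ` by trace-free Hermitian or skew-Hermitian quaternionic
matrices which generate the algebra of quaternionic matrices. -/
structure VectorModel (n : ℕ) (m : Type) [Fintype m] [DecidableEq m] where
  J : Matrix m m ℂ
  J_mul_J : J * J = -1
  J_conj : J.map (starRingEnd ℂ) = J
  J_conjTranspose : J.conjTranspose = -J
  γ : (Fin n → ℝ) →ₗ[ℝ] Matrix m m ℂ
  δ : ℝ
  δ_mul_δ : δ * δ = 1
  γ_mem : ∀ x, γ x ∈ quaternionic J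
  conjTranspose_γ : ∀ x, (γ x).conjTranspose = δ • γ x
  trace_γ : ∀ x, (γ x).trace = 0
  γ_mul_γ : ∀ x, γ x * γ x = (δ * ∑ i, x i ^ 2) • 1
  exists_γ_eq : ∀ Y ∈ quaternionic J, Y.conjTranspose = δ • Y → Y.trace = 0 → ∃ y, γ y = Y
  -- Products of two vectors generate the even Clifford algebra; this field makes the even part map
  -- onto all quaternionic matrices.
  quaternionic_le : ∀ S : Subalgebra ℝ (Matrix m m ℂ), (∀ x y, γ x * γ y ∈ S) →
    quaternionic J ≤ S
  -- The dimension bound behind injectivity of the representation.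
  two_pow_le : 2 ^ n ≤ 2 * Fintype.card m ^ 2

/-- The quaternionic unitary matrices. -/
def VectorModel.IsUnitary {n : ℕ} {m : Type} [Fintype m] [DecidableEq m]
    (V : VectorModel n m) (X : Matrix m m ℂ) : Prop :=
  X ∈ quaternionic V.J ∧ X * X.conjTranspose = 1

theorem VectorModel.exists_conj {n : ℕ} {m : Type} [Fintype m] [DecidableEq m]
    (V : VectorModel n m) {X : Matrix m m ℂ} (hX : X ∈ quaternionic V.J)
    (h : X * X.conjTranspose = 1) (x : Fin n → ℝ) :
    ∃ y, V.γ y = X * V.γ x * X.conjTranspose := by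
  refine V.exists_γ_eq _ ?_ ?_ ?_
  · exact mul_mem (mul_mem hX (V.γ_mem x))
      (conjTranspose_mem_quaternionic V.J_mul_J V.J_conjTranspose hX)
  · rw [Matrix.conjTranspose_mul, Matrix.conjTranspose_mul, Matrix.conjTranspose_conjTranspose,
      V.conjTranspose_γ, Matrix.smul_mul, Matrix.mul_smul, mul_assoc]
  · rw [Matrix.trace_mul_comm, ← mul_assoc, mul_eq_one_comm.1 h, one_mul, V.trace_γ]

theorem finrank_Cl (p q : ℕ) : Module.finrank ℝ (Cl p q) = 2 ^ (p + q) := by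
  have : Invertible (2 : ℝ) := invertibleOfNonzero two_ne_zero
  rw [(equivExterior (form p q)).finrank_eq,
    Module.finrank_eq_card_basis (Pi.basisFun ℝ (Fin (p + q))).ExteriorAlgebra]
  simp

instance (p q : ℕ) : Module.Finite ℝ (Cl p q) := by
  have : Invertible (2 : ℝ) := invertibleOfNonzero two_ne_zero
  have := Module.Finite.of_basis (Pi.basisFun ℝ (Fin (p + q))).ExteriorAlgebra
  exact Module.Finite.equiv (equivExterior (form p q)).symm

/-- The diagonal entries of XX* are sums of squared absolute values. -/
theorem mul_conjTranspose_self_ne {m : Type*} [Fintype m] [DecidableEq m] [Nonempty m]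
    (X : Matrix m m ℂ) : X * X.conjTranspose ≠ -1 := by
  intro h
  obtain ⟨i⟩ := ‹Nonempty m›
  have h1 := congrArg Complex.re (congrFun (congrFun h i) i)
  simp only [Matrix.mul_apply, Matrix.conjTranspose_apply, Matrix.neg_apply,
    Matrix.one_apply_eq, Complex.re_sum, Complex.star_def, Complex.mul_conj, Complex.ofReal_re,
    Complex.neg_re, Complex.one_re] at h1
  have h2 : 0 ≤ ∑ j, Complex.normSq (X i j) :=
    Finset.sum_nonneg fun j _ => Complex.normSq_nonneg _
  linarith

/-! ### The Clifford representation and the image of the Pin group -/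

section Representation

variable {p q : ℕ} {m : Type} [Fintype m] [DecidableEq m] {R : Type} [CommRing R] [Algebra ℝ R]
  (V : VectorModel (p + q) m) (k : ℂ →ₐ[ℝ] R) (c : R) (η : ℝ)

theorem VectorModel.clifford_relation
    (hform : ∀ x, form p q x = η * ∑ i, x i ^ 2)
    (hc : c * c = algebraMap ℝ R (V.δ * η)) (x : Fin (p + q) → ℝ) :
    (c • k.mapMatrix (V.γ x)) * (c • k.mapMatrix (V.γ x)) =
      algebraMap ℝ (Matrix m m R) (form p q x) := by
  rw [Matrix.smul_mul, Matrix.mul_smul, smul_smul, ← map_mul, V.γ_mul_γ, hc, map_smul, map_one,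
    algebraMap_smul, smul_smul, Algebra.algebraMap_eq_smul_one, hform]
  congr 1
  linear_combination (∑ i, x i ^ 2) * η * V.δ_mul_δ

/-- The representation of the Clifford algebra which sends a vector `x` to `c γ(x)`. -/
noncomputable def VectorModel.rep (hform : ∀ x, form p q x = η * ∑ i, x i ^ 2)
    (hc : c * c = algebraMap ℝ R (V.δ * η)) : Cl p q →ₐ[ℝ] Matrix m m R :=
  lift (form p q) ⟨(LinearMap.lsmul R (Matrix m m R) c).restrictScalars ℝ ∘ₗ
    (k.mapMatrix.toLinearMap ∘ₗ V.γ), V.clifford_relation k c η hform hc⟩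

variable {η c} (hη : η * η = 1) (hform : ∀ x, form p q x = η * ∑ i, x i ^ 2)
  (hc : c * c = algebraMap ℝ R (V.δ * η))

local notation "φ" => VectorModel.rep V k c η hform hc

theorem VectorModel.rep_ι (x : Fin (p + q) → ℝ) :
    φ (ι (form p q) x) = c • k.mapMatrix (V.γ x) :=
  lift_ι_apply _ _ _

theorem VectorModel.rep_ι_mul_ι (x y : Fin (p + q) → ℝ) :
    φ (ι (form p q) x * ι (form p q) y) = k.mapMatrix ((V.δ * η) • (V.γ x * V.γ y)) := by
  rw [map_mul, V.rep_ι, V.rep_ι, Matrix.smul_mul, Matrix.mul_smul, smul_smul, hc,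
    algebraMap_smul, map_smul, map_mul]

/-- The factor c occurs in pairs, and c² is real, so no c survives. Reversing a product of two
vectors matches the adjoint because the two signs δ cancel. -/
theorem VectorModel.exists_rep_even (s : Cl p q) (hs : s ∈ evenOdd (form p q) 0) :
    ∃ X ∈ quaternionic V.J, φ s = k.mapMatrix X ∧
      φ (reverse s) = k.mapMatrix X.conjTranspose := by
  induction s, hs using even_induction with
  | algebraMap r =>
    refine ⟨algebraMap ℝ _ r, Subalgebra.algebraMap_mem _ _, ?_, ?_⟩
    · rw [AlgHom.commutes, AlgHom.commutes]
    · rw [reverse.commutes, AlgHom.commutes, Algebra.algebraMap_eq_smul_one,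
        Algebra.algebraMap_eq_smul_one, Matrix.conjTranspose_smul, Matrix.conjTranspose_one,
        map_smul, map_one, star_trivial]
  | add x y hx hy ihx ihy =>
    obtain ⟨X, hX, h1, h2⟩ := ihx
    obtain ⟨Y, hY, h3, h4⟩ := ihy
    refine ⟨X + Y, add_mem hX hY, ?_, ?_⟩
    · rw [map_add, map_add, h1, h3]
    · rw [map_add, map_add, Matrix.conjTranspose_add, map_add, h2, h4]
  | ι_mul_ι_mul x y s hs ih =>
    obtain ⟨X, hX, h1, h2⟩ := ih
    refine ⟨((V.δ * η) • (V.γ x * V.γ y)) * X,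
      mul_mem (Subalgebra.smul_mem _ (mul_mem (V.γ_mem x) (V.γ_mem y)) _) hX, ?_, ?_⟩
    · rw [map_mul, V.rep_ι_mul_ι, h1, map_mul]
    · rw [reverse.map_mul, reverse.map_mul, reverse_ι, reverse_ι, map_mul, V.rep_ι_mul_ι, h2,
        ← map_mul, Matrix.conjTranspose_mul, Matrix.conjTranspose_smul, Matrix.conjTranspose_mul,
        V.conjTranspose_γ, V.conjTranspose_γ, star_trivial, Matrix.smul_mul V.δ,
        Matrix.mul_smul _ V.δ, smul_smul V.δ, V.δ_mul_δ, one_smul]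

include hη in
theorem VectorModel.exists_even_rep_eq {X : Matrix m m ℂ} (hX : X ∈ quaternionic V.J) :
    ∃ s ∈ evenOdd (form p q) 0, φ s = k.mapMatrix X := by
  have h := V.quaternionic_le (((even (form p q)).map φ).comap k.mapMatrix) (by
    intro x y
    refine ⟨(V.δ * η) • (ι (form p q) x * ι (form p q) y),
      Subalgebra.smul_mem _ (ι_mul_ι_mem_evenOdd_zero _ _ _) _, ?_⟩
    show φ ((V.δ * η) • (ι (form p q) x * ι (form p q) y)) = k.mapMatrix (V.γ x * V.γ y)
    rw [map_smul, V.rep_ι_mul_ι, ← map_smul, smul_smul]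
    have : V.δ * η * (V.δ * η) = 1 := by linear_combination η * η * V.δ_mul_δ + hη
    rw [this, one_smul])
  obtain ⟨s, hs, h⟩ := h hX
  exact ⟨s, hs, h⟩

variable (h0 : 0 < p + q)

/-- The first vector of the standard basis. -/
def unitVector (h0 : 0 < p + q) : Fin (p + q) → ℝ := Pi.single ⟨0, h0⟩ 1

theorem sum_unitVector_sq : ∑ i, unitVector h0 i ^ 2 = 1 := by
  simp [unitVector, Pi.single_apply, ite_pow]

theorem VectorModel.γ_unitVector_mul_self :
    V.γ (unitVector h0) * V.γ (unitVector h0) = V.δ • 1 := by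
  rw [V.γ_mul_γ, sum_unitVector_sq, mul_one]

include hη h0 in
-- With u the unit vector, cX = cγ(u) · δγ(u)X since γ(u)² = δ, and δγ(u)X already comes from an
-- even element.
theorem VectorModel.exists_rep_eq_smul {X : Matrix m m ℂ} (hX : X ∈ quaternionic V.J) :
    ∃ s, φ s = c • k.mapMatrix X := by
  obtain ⟨s, -, hs⟩ := V.exists_even_rep_eq k hη hform hc
    (Subalgebra.smul_mem _ (mul_mem (V.γ_mem (unitVector h0)) hX) V.δ)
  refine ⟨ι (form p q) (unitVector h0) * s, ?_⟩
  rw [map_mul, hs, V.rep_ι, Matrix.smul_mul, ← map_mul, Matrix.mul_smul, ← mul_assoc,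
    V.γ_unitVector_mul_self, Matrix.smul_mul, one_mul, smul_smul, V.δ_mul_δ, one_smul]

include hη h0 in
-- The image contains A ⊕ cA, of dimension at least 2 · (card m)² ≥ 2^(p+q), the dimension of the
-- Clifford algebra; no room is left for a kernel.
theorem VectorModel.rep_injective (hk : ∀ X ∈ quaternionic V.J, ∀ Y ∈ quaternionic V.J,
    k.mapMatrix X + c • k.mapMatrix Y = 0 → X = 0 ∧ Y = 0) : Function.Injective φ := by
  let F : (quaternionic V.J × quaternionic V.J) →ₗ[ℝ] Matrix m m R :=
    (k.mapMatrix.toLinearMap ∘ₗ (quaternionic V.J).val.toLinearMap).coprod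
      ((LinearMap.lsmul R (Matrix m m R) c).restrictScalars ℝ ∘ₗ
        (k.mapMatrix.toLinearMap ∘ₗ (quaternionic V.J).val.toLinearMap))
  have hF : Function.Injective F := by
    rw [← LinearMap.ker_eq_bot, LinearMap.ker_eq_bot']
    rintro ⟨X, Y⟩ h
    obtain ⟨h1, h2⟩ := hk X X.2 Y Y.2 h
    exact Prod.ext (Subtype.ext h1) (Subtype.ext h2)
  have hr : LinearMap.range F ≤ LinearMap.range (φ).toLinearMap := by
    rintro _ ⟨⟨X, Y⟩, rfl⟩
    obtain ⟨s, -, hs⟩ := V.exists_even_rep_eq k hη hform hc X.2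
    obtain ⟨t, ht⟩ := V.exists_rep_eq_smul k hη hform hc h0 Y.2
    refine ⟨s + t, ?_⟩
    show φ (s + t) = _
    rw [map_add, hs, ht]
    rfl
  have h1 := Submodule.finrank_mono hr
  rw [LinearMap.finrank_range_of_inj hF, Module.finrank_prod] at h1
  have h2 := card_sq_le_finrank_quaternionic V.J_mul_J V.J_conj
  have h3 := V.two_pow_le
  have h4 := LinearMap.finrank_range_add_finrank_ker (φ).toLinearMap
  rw [finrank_Cl] at h4
  have h5 : Module.finrank ℝ (LinearMap.ker (φ).toLinearMap) = 0 := by omega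
  exact LinearMap.ker_eq_bot.1 (Submodule.finrank_eq_zero.1 h5)

theorem isHomogeneous_ι (x : Fin (p + q) → ℝ) : IsHomogeneous (ι (form p q) x) :=
  Or.inr (ι_mem_evenOdd_one _ _)

variable {V} in
theorem VectorModel.IsUnitary.mul {X Y : Matrix m m ℂ} (hX : V.IsUnitary X)
    (hY : V.IsUnitary Y) : V.IsUnitary (X * Y) :=
  ⟨mul_mem hX.1 hY.1, by
    rw [Matrix.conjTranspose_mul, mul_assoc, ← mul_assoc Y, hY.2, one_mul, hX.2]⟩

theorem VectorModel.isUnitary_γ_unitVector : V.IsUnitary (V.γ (unitVector h0)) :=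
  ⟨V.γ_mem _, by
    rw [V.conjTranspose_γ, Matrix.mul_smul, V.γ_unitVector_mul_self, smul_smul, V.δ_mul_δ,
      one_smul]⟩

variable {V} in
theorem VectorModel.IsUnitary.smul {X : Matrix m m ℂ} (hX : V.IsUnitary X) {r : ℝ}
    (hr : r * r = 1) : V.IsUnitary (r • X) :=
  ⟨Subalgebra.smul_mem _ hX.1 _, by
    rw [Matrix.conjTranspose_smul, star_trivial, Matrix.smul_mul, Matrix.mul_smul, smul_smul, hr,
      one_smul, hX.2]⟩

section Injective

variable (hk : ∀ X ∈ quaternionic V.J, ∀ Y ∈ quaternionic V.J,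
    k.mapMatrix X + c • k.mapMatrix Y = 0 → X = 0 ∧ Y = 0)

include hk in
theorem VectorModel.mapMatrix_injOn {X Y : Matrix m m ℂ} (hX : X ∈ quaternionic V.J)
    (hY : Y ∈ quaternionic V.J) (h : k.mapMatrix X = k.mapMatrix Y) : X = Y := by
  have h1 := hk (X - Y) (sub_mem hX hY) 0 (zero_mem _) (by rw [map_sub, h]; simp)
  exact sub_eq_zero.1 h1.1

include hk in
theorem VectorModel.rep_pin_even [Nonempty m] {s : (Cl p q)ˣ} (hs : s ∈ Pin p q)
    (he : (s : Cl p q) ∈ evenOdd (form p q) 0) :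
    ∃ X, V.IsUnitary X ∧ φ (s : Cl p q) = k.mapMatrix X := by
  obtain ⟨X, hX, h1, h2⟩ := V.exists_rep_even k hform hc _ he
  have hX' := conjTranspose_mem_quaternionic V.J_mul_J V.J_conjTranspose hX
  have hN : φ (spinorNorm (s : Cl p q)) = k.mapMatrix (X * X.conjTranspose) := by
    rw [spinorNorm, map_mul, h1, h2, map_mul]
  refine ⟨X, ⟨hX, ?_⟩, h1⟩
  rcases hs.2 with h | h
  · rw [h, map_one] at hN
    exact V.mapMatrix_injOn k hk (mul_mem hX hX') (one_mem _) (by rw [← hN, map_one])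
  · rw [h, map_neg, map_one] at hN
    refine absurd (V.mapMatrix_injOn k hk (mul_mem hX hX') (neg_mem (one_mem _)) ?_)
      (mul_conjTranspose_self_ne X)
    rw [← hN, map_neg, map_one]

include hη h0 hk in
theorem VectorModel.exists_pin_even {X : Matrix m m ℂ} (hX : V.IsUnitary X) :
    ∃ s ∈ Pin p q, φ ((s : (Cl p q)ˣ) : Cl p q) = k.mapMatrix X := by
  have hinj := V.rep_injective k hη hform hc h0 hk
  obtain ⟨s, he, hs⟩ := V.exists_even_rep_eq k hη hform hc hX.1
  obtain ⟨X', hX', h1, h2⟩ := V.exists_rep_even k hform hc _ he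
  obtain rfl := V.mapMatrix_injOn k hk hX.1 hX' (hs.symm.trans h1)
  have h3 : s * reverse s = 1 := hinj (by rw [map_mul, h1, h2, ← map_mul, hX.2, map_one, map_one])
  have h4 : reverse s * s = 1 := hinj (by
    rw [map_mul, h1, h2, ← map_mul, mul_eq_one_comm.1 hX.2, map_one, map_one])
  -- The inverse of s is its reversion, which acts as X*.
  refine ⟨⟨s, reverse s, h3, h4⟩, ⟨⟨Or.inl he, fun x => ?_⟩, Or.inl h3⟩, hs⟩
  obtain ⟨y, hy⟩ := V.exists_conj hX.1 hX.2 x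
  refine ⟨y, hinj ?_⟩
  show φ (s * _ * reverse s) = _
  rw [map_mul, map_mul, h1, h2, V.rep_ι, V.rep_ι, hy, map_mul, map_mul, Matrix.mul_smul,
    Matrix.smul_mul]

include hform in
theorem ι_unitVector_mul_self :
    ι (form p q) (unitVector h0) * ι (form p q) (unitVector h0) = algebraMap ℝ _ η := by
  rw [ι_sq_scalar, hform, sum_unitVector_sq, mul_one]

include hη hform hc hk in
theorem VectorModel.exists_unit_ι_unitVector :
    ∃ e ∈ Pin p q, ((e : (Cl p q)ˣ) : Cl p q) = ι (form p q) (unitVector h0) := by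
  have hinj := V.rep_injective k hη hform hc h0 hk
  set e := ι (form p q) (unitVector h0) with he
  have h1 : e * e = algebraMap ℝ _ η := ι_unitVector_mul_self hform h0
  have h2 : e * (η • e) = 1 := by
    rw [mul_smul_comm, h1, Algebra.algebraMap_eq_smul_one, smul_smul, hη, one_smul]
  have h3 : (η • e) * e = 1 := by rw [smul_mul_assoc, ← mul_smul_comm, h2]
  -- Since e² = η = ±1, the inverse is ηe, and conjugation by e acts on vectors as γ(e)γ(x)γ(e)*.
  refine ⟨⟨e, η • e, h2, h3⟩, ⟨⟨isHomogeneous_ι _, fun x => ?_⟩, ?_⟩, rfl⟩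
  · obtain ⟨y, hy⟩ := V.exists_conj (V.isUnitary_γ_unitVector h0).1
      (V.isUnitary_γ_unitVector h0).2 x
    refine ⟨y, hinj ?_⟩
    show φ (e * _ * (η • e)) = _
    rw [mul_smul_comm, map_smul, map_mul, he, V.rep_ι_mul_ι, V.rep_ι, V.rep_ι, hy,
      V.conjTranspose_γ, Matrix.mul_smul, ← map_mul, Matrix.smul_mul, Matrix.mul_smul, map_smul,
      map_smul, smul_comm c, smul_comm c, smul_smul]
    congr 1
    linear_combination V.δ * hη
  · show e * reverse e = 1 ∨ e * reverse e = -1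
    rw [he, reverse_ι, ← he, h1]
    rcases mul_self_eq_one_iff.1 hη with h | h
    · left; rw [h, map_one]
    · right; rw [h, map_neg, map_one]

end Injective

end Representation

/-- The finite-dimensional topology of the Clifford algebra is the one pulled back along any
injective linear map to a Hausdorff topological vector space. -/
theorem isInducing_pin {p q : ℕ} {A : Type*} [AddCommGroup A] [Module ℝ A] [TopologicalSpace A]
    [IsTopologicalAddGroup A] [ContinuousSMul ℝ A] [T2Space A] (F : Cl p q →ₗ[ℝ] A)
    (hF : Function.Injective F) :
    Topology.IsInducing (fun s : Pin p q => F ((s : (Cl p q)ˣ) : Cl p q)) := by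
  let _ : TopologicalSpace (Cl p q) := moduleTopology ℝ (Cl p q)
  have : IsModuleTopology ℝ (Cl p q) := ⟨rfl⟩
  have : ContinuousSMul ℝ (Cl p q) := ModuleTopology.continuousSMul ℝ (Cl p q)
  have : IsTopologicalAddGroup (Cl p q) := IsModuleTopology.topologicalAddGroup ℝ (Cl p q)
  have : T2Space (Cl p q) :=
    T2Space.of_injective_continuous hF (IsModuleTopology.continuous_of_linearMap F)
  have h1 : Topology.IsClosedEmbedding F :=
    LinearMap.isClosedEmbedding_of_injective (LinearMap.ker_eq_bot.2 hF)
  exact h1.isInducing.comp ⟨rfl⟩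

/-! ### The isomorphism of Pin with S ∪ cS -/

section Representation

variable {p q : ℕ} {m : Type} [Fintype m] [DecidableEq m] [Nonempty m]
  {R : Type} [CommRing R] [Algebra ℝ R]
  (V : VectorModel (p + q) m) (k : ℂ →ₐ[ℝ] R) {c : R} {η : ℝ} (hη : η * η = 1)
  (hform : ∀ x, form p q x = η * ∑ i, x i ^ 2)
  (hc : c * c = algebraMap ℝ R (V.δ * η)) (h0 : 0 < p + q)
  (hk : ∀ X ∈ quaternionic V.J, ∀ Y ∈ quaternionic V.J,
    k.mapMatrix X + c • k.mapMatrix Y = 0 → X = 0 ∧ Y = 0)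
  {S : Submonoid (Matrix m m R)} (hcS : (c * c) • (1 : Matrix m m R) ∈ S)
  (hS : ∀ a, a ∈ S ↔ ∃ X, V.IsUnitary X ∧ k.mapMatrix X = a)

local notation "φ" => VectorModel.rep V k c η hform hc

include hη h0 hk hS in
theorem VectorModel.rep_mem {s : (Cl p q)ˣ} (hs : s ∈ Pin p q) :
    φ (s : Cl p q) ∈ unionScalar S c hcS := by
  rcases hs.1.1 with he | ho
  · obtain ⟨X, hX, h⟩ := V.rep_pin_even k hform hc hk hs he
    exact Or.inl ((hS _).2 ⟨X, hX, h.symm⟩)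
  · obtain ⟨e, he, he'⟩ := V.exists_unit_ι_unitVector k hη hform hc h0 hk
    have h1 : ((e * s : (Cl p q)ˣ) : Cl p q) ∈ evenOdd (form p q) 0 := by
      have := SetLike.mul_mem_graded (ι_mem_evenOdd_one (form p q) (unitVector h0)) ho
      rw [Units.val_mul, he']
      exact this
    obtain ⟨X, hX, h⟩ := V.rep_pin_even k hform hc hk (mul_mem he hs) h1
    refine Or.inr ⟨_, (hS _).2
      ⟨_, ((V.isUnitary_γ_unitVector h0).mul hX).smul hη, rfl⟩, ?_⟩
    -- An odd s is recovered from the even element es through e² = η.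
    have h2 : (s : Cl p q) = η • (ι (form p q) (unitVector h0) * (e * s : (Cl p q)ˣ)) := by
      rw [Units.val_mul, he', ← mul_assoc, ι_unitVector_mul_self hform h0, ← Algebra.smul_def,
        smul_smul, hη, one_smul]
    rw [h2, map_smul, map_mul, h, V.rep_ι, Matrix.smul_mul, map_smul, map_mul, smul_comm]

omit [Nonempty m] in
include hη h0 hk hS in
theorem VectorModel.exists_pin_rep_eq {a : Matrix m m R} (ha : a ∈ unionScalar S c hcS) :
    ∃ s ∈ Pin p q, φ ((s : (Cl p q)ˣ) : Cl p q) = a := by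
  rcases ha with ha | ⟨b, hb, rfl⟩
  · obtain ⟨X, hX, rfl⟩ := (hS a).1 ha
    exact V.exists_pin_even k hη hform hc h0 hk hX
  · obtain ⟨X, hX, rfl⟩ := (hS b).1 hb
    obtain ⟨e, he, he'⟩ := V.exists_unit_ι_unitVector k hη hform hc h0 hk
    obtain ⟨s, hs, h⟩ := V.exists_pin_even k hη hform hc h0 hk
      (((V.isUnitary_γ_unitVector h0).mul hX).smul V.δ_mul_δ)
    refine ⟨e * s, mul_mem he hs, ?_⟩
    rw [Units.val_mul, he', map_mul, h, V.rep_ι, Matrix.smul_mul, ← map_mul, Matrix.mul_smul,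
      ← mul_assoc, V.γ_unitVector_mul_self, Matrix.smul_mul, one_mul, smul_smul, V.δ_mul_δ,
      one_smul]

include hη hform hc h0 hk hS in
theorem VectorModel.nonempty_pin_equiv [TopologicalSpace R] [IsTopologicalRing R] [T2Space R]
    [ContinuousSMul ℝ R] : Nonempty (Pin p q ≃ₜ* unionScalar S c hcS) := by
  have hinj := V.rep_injective k hη hform hc h0 hk
  let F : Pin p q →* unionScalar S c hcS :=
    { toFun := fun s => ⟨φ ((s : (Cl p q)ˣ) : Cl p q), V.rep_mem k hη hform hc h0 hk hcS hS s.2⟩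
      map_one' := Subtype.ext (by simp)
      map_mul' := fun s t => Subtype.ext (by simp) }
  have hF : Function.Bijective F := by
    constructor
    · intro s t h
      exact Subtype.ext (Units.ext (hinj (congrArg Subtype.val h)))
    · rintro ⟨a, ha⟩
      obtain ⟨s, hs, h⟩ := V.exists_pin_rep_eq k hη hform hc h0 hk hcS hS ha
      exact ⟨⟨s, hs⟩, Subtype.ext h⟩
  have hI : Topology.IsInducing F :=
    (Topology.IsInducing.subtypeVal.of_comp_iff).1 (isInducing_pin (φ).toLinearMap hinj)
  let E := MulEquiv.ofBijective F hF
  exact ⟨{ E with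
    continuous_toFun := hI.continuous
    continuous_invFun := (E.toEquiv.toHomeomorphOfIsInducing hI).continuous_invFun }⟩

end Representation

/-! ### The model in dimension three: imaginary quaternions -/

/-- The vectors of `ℝ³` as trace-free skew-Hermitian `2 × 2` matrices. -/
noncomputable def pauliMap : (Fin 3 → ℝ) →ₗ[ℝ] Matrix (Fin 2) (Fin 2) ℂ where
  toFun x := !![⟨0, x 2⟩, ⟨x 1, x 0⟩; ⟨-x 1, x 0⟩, ⟨0, -x 2⟩]
  map_add' x y := by
    ext i j
    fin_cases i <;> fin_cases j <;> simp [Complex.ext_iff, add_comm]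
  map_smul' r x := by
    ext i j
    fin_cases i <;> fin_cases j <;> simp [Complex.ext_iff]

theorem pauliMap_apply (x : Fin 3 → ℝ) :
    pauliMap x = !![⟨0, x 2⟩, ⟨x 1, x 0⟩; ⟨-x 1, x 0⟩, ⟨0, -x 2⟩] := rfl

theorem pauliMap_mul_self (x : Fin 3 → ℝ) :
    pauliMap x * pauliMap x = (-1 * ∑ i, x i ^ 2) • 1 := by
  ext i j
  rw [pauliMap_apply]
  fin_cases i <;> fin_cases j <;>
    simp only [Complex.ext_iff] <;> constructor <;>
    simp [Matrix.mul_apply, Fin.sum_univ_three, sq] <;> ring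

theorem mem_quaternionic_fin_two {X : Matrix (Fin 2) (Fin 2) ℂ} :
    X ∈ quaternionic !![0, -1; 1, 0] ↔
      X 1 0 = -starRingEnd ℂ (X 0 1) ∧ X 1 1 = starRingEnd ℂ (X 0 0) := by
  rw [mem_quaternionic]
  constructor
  · intro h
    have h1 := congrFun (congrFun h 1) 1
    have h2 := congrFun (congrFun h 1) 0
    simp [Matrix.mul_apply] at h1 h2
    exact ⟨by rw [← h1, neg_neg], h2⟩
  · rintro ⟨h1, h2⟩
    ext i j
    fin_cases i <;> fin_cases j <;> simp [Matrix.mul_apply, h1, h2]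

theorem quaternionic_le_of_pauliMap (S : Subalgebra ℝ (Matrix (Fin 2) (Fin 2) ℂ))
    (hS : ∀ x y, pauliMap x * pauliMap y ∈ S) : quaternionic !![0, -1; 1, 0] ≤ S := by
  intro X hX
  obtain ⟨h1, h2⟩ := mem_quaternionic_fin_two.1 hX
  -- Cyclic products of two basis vectors are minus the third, so together with 1 they span the
  -- quaternions.
  have h : X = (X 0 0).re • 1 - (X 0 1).im • (pauliMap ![0, 1, 0] * pauliMap ![0, 0, 1])
      - (X 0 1).re • (pauliMap ![0, 0, 1] * pauliMap ![1, 0, 0])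
      - (X 0 0).im • (pauliMap ![1, 0, 0] * pauliMap ![0, 1, 0]) := by
    ext i j
    simp only [pauliMap_apply]
    fin_cases i <;> fin_cases j <;>
      simp [Complex.ext_iff, h1, h2]
  rw [h]
  exact sub_mem (sub_mem (sub_mem (S.smul_mem (one_mem S) _) (S.smul_mem (hS _ _) _))
    (S.smul_mem (hS _ _) _)) (S.smul_mem (hS _ _) _)

/-- Vectors of `ℝ³` as skew-Hermitian quaternionic matrices. -/
noncomputable def pauliModel : VectorModel 3 (Fin 2) where
  J := !![0, -1; 1, 0]
  J_mul_J := by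
    ext i j
    fin_cases i <;> fin_cases j <;> simp
  J_conj := by
    ext i j
    fin_cases i <;> fin_cases j <;> simp
  J_conjTranspose := by
    ext i j
    fin_cases i <;> fin_cases j <;> simp
  γ := pauliMap
  δ := -1
  δ_mul_δ := by norm_num
  γ_mem x := by
    rw [mem_quaternionic_fin_two, pauliMap_apply]
    simp [Complex.ext_iff]
  conjTranspose_γ x := by
    rw [pauliMap_apply]
    ext i j
    fin_cases i <;> fin_cases j <;> simp [Complex.ext_iff]
  trace_γ x := by simp [pauliMap_apply, Matrix.trace_fin_two, Complex.ext_iff]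
  γ_mul_γ := pauliMap_mul_self
  exists_γ_eq Y hY hs _ := by
    obtain ⟨h1, h2⟩ := mem_quaternionic_fin_two.1 hY
    refine ⟨![(Y 0 1).im, (Y 0 1).re, (Y 0 0).im], ?_⟩
    have h3 : (Y 0 0).re = -(Y 0 0).re := by
      simpa using congrArg Complex.re (congrFun (congrFun hs 0) 0)
    have h4 : (Y 0 0).re = 0 := by linarith
    ext i j
    rw [pauliMap_apply]
    fin_cases i <;> fin_cases j <;> simp [Complex.ext_iff, h1, h2, h4]
  quaternionic_le := quaternionic_le_of_pauliMap
  two_pow_le := by simp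

/-! ### The model in dimension five: Hermitian quaternionic matrices -/

/-- The vectors of `ℝ⁵` as trace-free Hermitian quaternionic `4 × 4` matrices. -/
noncomputable def diracMap :
    (Fin 5 → ℝ) →ₗ[ℝ] Matrix (Fin 2 ⊕ Fin 2) (Fin 2 ⊕ Fin 2) ℂ where
  toFun x := Matrix.fromBlocks
    !![⟨x 2, 0⟩, ⟨x 0, -x 1⟩; ⟨x 0, x 1⟩, ⟨-x 2, 0⟩] !![0, ⟨-x 3, x 4⟩; ⟨x 3, -x 4⟩, 0]
    !![0, ⟨x 3, x 4⟩; ⟨-x 3, -x 4⟩, 0] !![⟨x 2, 0⟩, ⟨x 0, x 1⟩; ⟨x 0, -x 1⟩, ⟨-x 2, 0⟩]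
  map_add' x y := by
    ext (i | i) (j | j) <;>
    fin_cases i <;> fin_cases j <;> simp [Complex.ext_iff, add_comm]
  map_smul' r x := by
    ext (i | i) (j | j) <;>
    fin_cases i <;> fin_cases j <;> simp [Complex.ext_iff]

theorem diracMap_apply (x : Fin 5 → ℝ) : diracMap x = Matrix.fromBlocks
    !![⟨x 2, 0⟩, ⟨x 0, -x 1⟩; ⟨x 0, x 1⟩, ⟨-x 2, 0⟩] !![0, ⟨-x 3, x 4⟩; ⟨x 3, -x 4⟩, 0]
    !![0, ⟨x 3, x 4⟩; ⟨-x 3, -x 4⟩, 0] !![⟨x 2, 0⟩, ⟨x 0, x 1⟩; ⟨x 0, -x 1⟩, ⟨-x 2, 0⟩] := rfl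

theorem diracMap_mul_self (x : Fin 5 → ℝ) :
    diracMap x * diracMap x = (1 * ∑ i, x i ^ 2) • 1 := by
  ext (i | i) (j | j) <;> rw [diracMap_apply] <;>
  fin_cases i <;> fin_cases j <;>
    simp only [Complex.ext_iff] <;> constructor <;>
    simp [Matrix.mul_apply, Fin.sum_univ_five, sq] <;> ring

theorem fromBlocks_mem_quaternionic {A B C D : Matrix (Fin 2) (Fin 2) ℂ} :
    Matrix.fromBlocks A B C D ∈ quaternionic (Matrix.J (Fin 2) ℂ) ↔
      B = -C.map (starRingEnd ℂ) ∧ D = A.map (starRingEnd ℂ) := by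
  rw [mem_quaternionic, Matrix.J, Matrix.fromBlocks_map, Matrix.fromBlocks_multiply,
    Matrix.fromBlocks_multiply, Matrix.fromBlocks_inj]
  simp only [mul_zero, mul_one, zero_add, add_zero, mul_neg, zero_mul, neg_mul, one_mul]
  constructor
  · rintro ⟨h1, -, h3, -⟩
    exact ⟨h1, h3⟩
  · rintro ⟨h1, h2⟩
    refine ⟨h1, ?_, h2, ?_⟩
    · rw [h2, map_conj_conj]
    · rw [h1, Matrix.map_neg _ (map_neg _), map_conj_conj]

/-- A complex `2 × 2` matrix as a block diagonal quaternionic `4 × 4` matrix. -/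
noncomputable def conjDiag :
    Matrix (Fin 2) (Fin 2) ℂ →ₐ[ℝ] Matrix (Fin 2 ⊕ Fin 2) (Fin 2 ⊕ Fin 2) ℂ :=
  AlgHom.ofLinearMap
    { toFun := fun A => Matrix.fromBlocks A 0 0 (A.map (starRingEnd ℂ))
      map_add' := fun A B => by
        simp [Matrix.fromBlocks_add, Matrix.map_add]
      map_smul' := fun r A => by
        ext (i | i) (j | j) <;> simp }
    (by simp [Matrix.map_one, Matrix.fromBlocks_one])
    (fun A B => by simp [Matrix.fromBlocks_multiply, Matrix.map_mul])

theorem conjDiag_apply (A : Matrix (Fin 2) (Fin 2) ℂ) :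
    conjDiag A = Matrix.fromBlocks A 0 0 (A.map (starRingEnd ℂ)) := rfl

/-- Products of the first three basis vectors give the Pauli matrices on the block diagonal, and the
product of the last two gives the scalar i there. These generate all diag(A, Ā); one
block-antidiagonal product then yields the rest. -/
theorem quaternionic_le_of_diracMap
    (S : Subalgebra ℝ (Matrix (Fin 2 ⊕ Fin 2) (Fin 2 ⊕ Fin 2) ℂ))
    (hS : ∀ x y, diracMap x * diracMap y ∈ S) : quaternionic (Matrix.J (Fin 2) ℂ) ≤ S := by
  have hI : Complex.I • (1 : Matrix (Fin 2) (Fin 2) ℂ) ∈ S.comap conjDiag := by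
    show conjDiag _ ∈ S
    convert hS ![0, 0, 0, 1, 0] ![0, 0, 0, 0, 1] using 1
    simp only [diracMap_apply, conjDiag_apply]
    ext (i | i) (j | j) <;> fin_cases i <;> fin_cases j <;>
      simp [Complex.ext_iff, Matrix.mul_apply]
  have hpauli : ∀ x, pauliMap x ∈ S.comap conjDiag := by
    intro x
    show conjDiag _ ∈ S
    have h : conjDiag (pauliMap x) =
        x 0 • (diracMap ![0, 1, 0, 0, 0] * diracMap ![0, 0, 1, 0, 0])
        + x 1 • (diracMap ![0, 0, 1, 0, 0] * diracMap ![1, 0, 0, 0, 0])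
        + x 2 • (diracMap ![1, 0, 0, 0, 0] * diracMap ![0, 1, 0, 0, 0]) := by
      simp only [diracMap_apply, conjDiag_apply, pauliMap_apply]
      ext (i | i) (j | j) <;> fin_cases i <;> fin_cases j <;>
        simp [Complex.ext_iff, Matrix.mul_apply]
    rw [h]
    exact add_mem (add_mem (S.smul_mem (hS _ _) _) (S.smul_mem (hS _ _) _))
      (S.smul_mem (hS _ _) _)
  have hD : ∀ A, conjDiag A ∈ S := by
    intro A
    show A ∈ S.comap conjDiag
    -- A split into its trace-free skew-Hermitian part, its trace-free Hermitian part (i times a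
    -- skew-Hermitian one) and the scalar tr(A)/2.
    have h : A = pauliMap ![((A 0 1).im + (A 1 0).im) / 2, ((A 0 1).re - (A 1 0).re) / 2,
          ((A 0 0).im - (A 1 1).im) / 2]
        + (Complex.I • 1) * pauliMap ![-((A 0 1).re + (A 1 0).re) / 2,
          ((A 0 1).im - (A 1 0).im) / 2, ((A 1 1).re - (A 0 0).re) / 2]
        + ((((A 0 0).re + (A 1 1).re) / 2) • 1
        + (((A 0 0).im + (A 1 1).im) / 2) • (Complex.I • 1)) := by
      simp only [pauliMap_apply, Matrix.smul_mul, one_mul]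
      ext i j
      fin_cases i <;> fin_cases j <;> simp only [Complex.ext_iff] <;> constructor <;>
        simp <;> ring
    rw [h]
    exact add_mem (add_mem (hpauli _) (mul_mem hI (hpauli _)))
      (add_mem (Subalgebra.smul_mem _ (one_mem _) _) (Subalgebra.smul_mem _ hI _))
  intro X hX
  rw [← Matrix.fromBlocks_toBlocks X, fromBlocks_mem_quaternionic] at hX
  -- Write X in blocks with left column A, C, and let E = diag(1, -1). The product of the two
  -- vectors has blocks -E, E off the diagonal, and E² = 1 leaves -C̄, C.
  have h : X = conjDiag X.toBlocks₁₁ + (diracMap ![0, 0, 0, 1, 0] * diracMap ![1, 0, 0, 0, 0]) *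
      conjDiag (!![1, 0; 0, -1] * X.toBlocks₂₁) := by
    have hE : (!![1, 0; 0, -1] : Matrix (Fin 2) (Fin 2) ℂ) * !![1, 0; 0, -1] = 1 := by
      ext i j
      fin_cases i <;> fin_cases j <;> simp
    have hE' : (!![1, 0; 0, -1] : Matrix (Fin 2) (Fin 2) ℂ).map (starRingEnd ℂ) =
        !![1, 0; 0, -1] := by
      ext i j
      fin_cases i <;> fin_cases j <;> simp
    have hK : diracMap ![0, 0, 0, 1, 0] * diracMap ![1, 0, 0, 0, 0] =
        Matrix.fromBlocks 0 (-!![1, 0; 0, -1]) !![1, 0; 0, -1] 0 := by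
      simp only [diracMap_apply]
      ext (i | i) (j | j) <;> fin_cases i <;> fin_cases j <;>
        simp [Complex.ext_iff, Matrix.mul_apply]
    conv_lhs => rw [← Matrix.fromBlocks_toBlocks X, hX.1, hX.2]
    rw [hK, conjDiag_apply, conjDiag_apply, Matrix.fromBlocks_multiply, Matrix.fromBlocks_add,
      Matrix.map_mul, hE']
    simp only [neg_mul, ← mul_assoc, hE]
    simp
  rw [h]
  exact add_mem (hD _) (mul_mem (hS _ _) (hD _))

/-- Vectors of `ℝ⁵` as Hermitian quaternionic matrices. -/
noncomputable def diracModel : VectorModel 5 (Fin 2 ⊕ Fin 2) where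
  J := Matrix.J (Fin 2) ℂ
  J_mul_J := Matrix.J_squared _ _
  J_conj := Matrix.map_J _ (starRingEnd ℂ)
  J_conjTranspose := by
    simp [Matrix.J, Matrix.fromBlocks_conjTranspose, Matrix.fromBlocks_neg]
  γ := diracMap
  δ := 1
  δ_mul_δ := by norm_num
  γ_mem x := by
    rw [diracMap_apply, fromBlocks_mem_quaternionic]
    constructor <;> ext i j <;> fin_cases i <;> fin_cases j <;> simp [Complex.ext_iff]
  conjTranspose_γ x := by
    rw [diracMap_apply]
    ext (i | i) (j | j) <;> fin_cases i <;> fin_cases j <;> simp [Complex.ext_iff]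
  trace_γ x := by
    simp [diracMap_apply, Matrix.trace, Complex.ext_iff]
  γ_mul_γ := diracMap_mul_self
  exists_γ_eq Y hY hs ht := by
    rw [← Matrix.fromBlocks_toBlocks Y] at hY hs ht
    set A := Y.toBlocks₁₁
    set C := Y.toBlocks₂₁
    rw [fromBlocks_mem_quaternionic] at hY
    rw [hY.1, hY.2, one_smul, Matrix.fromBlocks_conjTranspose, Matrix.fromBlocks_inj] at hs
    obtain ⟨hA, hC, -, -⟩ := hs
    rw [Matrix.trace, Fintype.sum_sum_type, hY.2] at ht
    have hA00 := congrFun (congrFun hA 0) 0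
    have hA01 := congrFun (congrFun hA 0) 1
    have hA11 := congrFun (congrFun hA 1) 1
    have hC00 := congrFun (congrFun hC 0) 0
    have hC01 := congrFun (congrFun hC 0) 1
    have hC11 := congrFun (congrFun hC 1) 1
    simp [Complex.ext_iff] at ht hA00 hA01 hA11 hC00 hC01 hC11
    refine ⟨![(A 1 0).re, (A 1 0).im, (A 0 0).re, (C 0 1).re, (C 0 1).im], ?_⟩
    rw [diracMap_apply, ← Matrix.fromBlocks_toBlocks Y, hY.1, hY.2]
    congr 1 <;> ext i j <;> fin_cases i <;> fin_cases j <;> simp only [Complex.ext_iff] <;>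
      constructor <;> simp <;> linarith
  quaternionic_le := quaternionic_le_of_diracMap
  two_pow_le := by simp

/-! ### Identification of SU(2) and Sp(2), and the choice of i or e -/

theorem mem_SU2_iff (X : Matrix (Fin 2) (Fin 2) ℂ) : X ∈ SU2 ↔ pauliModel.IsUnitary X := by
  rw [Matrix.mem_specialUnitaryGroup_iff, Matrix.mem_unitaryGroup_iff, and_comm]
  refine and_congr_left fun h => ?_
  show _ ↔ X ∈ quaternionic !![0, -1; 1, 0]
  -- In size two every X scales the symplectic form by det X, so preserving J means det X = 1.
  have h1 : X * !![0, -1; 1, 0] * X.transpose = X.det • !![0, -1; 1, 0] := by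
    ext i j
    fin_cases i <;> fin_cases j <;> simp [Matrix.mul_apply, Matrix.det_fin_two] <;> ring
  rw [mem_quaternionic_iff_of_unitary h, h1]
  constructor
  · intro hd
    rw [hd, one_smul]
  · intro hd
    simpa using congrFun (congrFun hd 1) 0

theorem mem_Sp2_iff (X : Matrix (Fin 2 ⊕ Fin 2) (Fin 2 ⊕ Fin 2) ℂ) :
    X ∈ Sp2 ↔ diracModel.IsUnitary X := by
  rw [Sp2, Submonoid.mem_inf, Matrix.mem_unitaryGroup_iff, SymplecticGroup.mem_iff, and_comm]
  exact and_congr_left fun h => (mem_quaternionic_iff_of_unitary h).symm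

section Targets

variable {p q : ℕ} {m : Type} [Fintype m] [DecidableEq m] [Nonempty m]
  (V : VectorModel (p + q) m) {η : ℝ} (hη : η * η = 1)
  (hform : ∀ x, form p q x = η * ∑ i, x i ^ 2) (h0 : 0 < p + q)
  {S : Submonoid (Matrix m m ℂ)} (hS : ∀ X, X ∈ S ↔ V.IsUnitary X)

include hη hform h0 hS in
theorem VectorModel.nonempty_pin_equiv_complex (hδ : V.δ * η = -1)
    (hcS : (Complex.I * Complex.I) • (1 : Matrix m m ℂ) ∈ S) :
    Nonempty (Pin p q ≃ₜ* unionScalar S Complex.I hcS) := by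
  refine V.nonempty_pin_equiv (AlgHom.id ℝ ℂ) hη hform (by rw [hδ]; simp) h0 ?_ hcS ?_
  · intro X hX Y hY h
    exact quaternionic_eq_zero V.J_mul_J hX hY (by simpa using h)
  · intro a
    rw [hS]
    simp

/-- The diagonal inclusion of the complex numbers, as a homomorphism of real algebras. -/
def ofComplexAlgHom : ℂ →ₐ[ℝ] DoubleComplex where
  toRingHom := ofComplex
  commutes' _ := rfl

include hη hform h0 hS in
theorem VectorModel.nonempty_pin_equiv_doubleComplex (hδ : V.δ * η = 1)
    (hcS : (doubleUnit * doubleUnit) • (1 : Matrix m m DoubleComplex) ∈ toDouble S) :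
    Nonempty (Pin p q ≃ₜ* unionScalar (toDouble S) doubleUnit hcS) := by
  refine V.nonempty_pin_equiv ofComplexAlgHom hη hform
    (by rw [hδ, doubleUnit_mul_self, map_one]) h0 ?_ hcS ?_
  · intro X _ Y _ h
    -- The two components of ℂ × ℂ read X + Y = 0 and X - Y = 0, since e = (1, -1).
    have h1 : ∀ i j, X i j + Y i j = 0 ∧ X i j + -Y i j = 0 := by
      intro i j
      have h2 := congrFun (congrFun h i) j
      simpa [ofComplexAlgHom, ofComplex, doubleUnit, Prod.ext_iff] using h2
    constructor <;> ext i j <;> simp only [Matrix.zero_apply]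
    · linear_combination (1 / 2) * (h1 i j).1 + (1 / 2) * (h1 i j).2
    · linear_combination (1 / 2) * (h1 i j).1 - (1 / 2) * (h1 i j).2
  · intro a
    rw [toDouble, Submonoid.mem_map]
    simp only [hS]
    rfl

end Targets

theorem form_zero_right (p : ℕ) (x : Fin (p + 0) → ℝ) :
    form p 0 x = 1 * ∑ i, x i ^ 2 := by
  rw [form, QuadraticMap.weightedSumSquares_apply, one_mul]
  refine Finset.sum_congr rfl fun i _ => ?_
  rw [if_pos (show (i : ℕ) < p from i.2), one_smul, sq]

theorem form_zero_left (q : ℕ) (x : Fin (0 + q) → ℝ) :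
    form 0 q x = -1 * ∑ i, x i ^ 2 := by
  rw [form, QuadraticMap.weightedSumSquares_apply, Finset.mul_sum]
  refine Finset.sum_congr rfl fun i _ => ?_
  rw [if_neg (Nat.not_lt_zero _), smul_eq_mul, sq]

end CliffordLipschitz

theorem mainTheorem10 :
    Nonempty (CliffordLipschitz.Pin 3 0 ≃ₜ* CliffordLipschitz.SU2UnionI) ∧
    Nonempty (CliffordLipschitz.Pin 0 3 ≃ₜ* CliffordLipschitz.SU2UnionE) ∧
    Nonempty (CliffordLipschitz.Pin 5 0 ≃ₜ* CliffordLipschitz.Sp2UnionE) ∧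
    Nonempty (CliffordLipschitz.Pin 0 5 ≃ₜ* CliffordLipschitz.Sp2UnionI) := by
  open CliffordLipschitz in
  refine ⟨?_, ?_, ?_, ?_⟩
  · exact VectorModel.nonempty_pin_equiv_complex (p := 3) (q := 0) pauliModel (by norm_num)
      (form_zero_right 3) (by norm_num) mem_SU2_iff (by norm_num [pauliModel]) _
  · exact VectorModel.nonempty_pin_equiv_doubleComplex (p := 0) (q := 3) pauliModel (by norm_num)
      (form_zero_left 3) (by norm_num) mem_SU2_iff (by norm_num [pauliModel]) _
  · exact VectorModel.nonempty_pin_equiv_doubleComplex (p := 5) (q := 0) diracModel (by norm_num)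
      (form_zero_right 5) (by norm_num) mem_Sp2_iff (by norm_num [diracModel]) _
  · exact VectorModel.nonempty_pin_equiv_complex (p := 0) (q := 5) diracModel (by norm_num)
      (form_zero_left 5) (by norm_num) mem_Sp2_iff (by norm_num [diracModel]) _
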